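/- Let $\xi(t)$, $t\in\mathbb R$, be an $\mathbb R^d$-valued Gaussian process (its finite-dimensional distributions may be degenerate), let $P_t$ be the distribution of $\xi(t)$, and let $\Sigma(s,t)$ be the matrix of covariances of the components of $\xi(s)$ with the components of $\xi(t)$. Let $\Lambda$ be a non-zero measure on $\mathbb R^d$ such that $\Lambda*P_t$ is locally finite for all $t\in\mathbb R$. The particle system generated by $(\Lambda,\xi)$ is the family of point processes, counted with multiplicities, $$N(t_1,\dots,t_n)=\{(x_i+\xi_i(t_1),\dots,x_i+\xi_i(t_n))\}_i,\qquad n\ge 1,\ t_1,\dots,t_n\in\mathbb R,$$ in $(\mathbb R^{d})^n$, where $\{x_i\}$ are the points of a Poisson process on $\mathbb R^d$ with intensity measure $\Lambda$ and $\xi_1,\xi_2,\dots$ are i.i.d. copies of $\xi$ that are independent of this Poisson process. Assume that this system is stationary, i.e. $N(t_1,\dots,t_n)$ and $N(t_1+s,\dots,t_n+s)$ have the same distribution for all $n$ and all $s,t_1,\dots,t_n\in\mathbb R$. Assume that $P_{t_1}=P_{t_2}*\sigma$ for some Gaussian measure $\sigma$ on $\mathbb R^d$ and some $t_1\neq t_2$,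 and that for no $u\in\mathbb R^d\setminus\{0\}$ the real-valued process $\langle u,\xi(t)-\mathbf E\xi(t)\rangle$, $t\in\mathbb R$, is stationary. Then there are $c_0>0$ and $\lambda\in\mathbb R^d$ such that $\Lambda=c_0\,\mathfrak e_\lambda$, where $\mathfrak e_\lambda$ is the measure on $\mathbb R^d$ with Lebesgue density $e^{-\langle\lambda,x\rangle}$, and, for this $\lambda$, $$\xi(t)=W(t)-\tfrac12\Sigma(t,t)\lambda+b(t)+c,\qquad t\in\mathbb R,$$ where $W$ is a centred Gaussian process with variance $\Sigma(t,t)$ and with wide sense stationary increments (the covariance matrix of $W(t_2)-W(t_1)$ depends only on $t_1-t_2$), $c\in\mathbb R^d$ is deterministic, and $b:\mathbb R\to\mathbb R^d$ is a function with $\langle b(t),\lambda\rangle=0$ for all $t$ such that $$b(t_2)-b(t_1)+\tfrac12\big(\Sigma(t_2,t_1)-\Sigma(t_1,t_2)\big)\lambda$$ depends only on the difference $t_2-t_1$. -/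

import Mathlib

open MeasureTheory ProbabilityTheory
open scoped ENNReal NNReal

namespace ParticleSystem

/-- The Euclidean space `ℝ^d`. -/
abbrev Eu (d : ℕ) : Type := EuclideanSpace ℝ (Fin d)

/-- `Φ` is a Poisson point process (as a random measure) with intensity measure `Λ`: the
numbers of points in sets of finite intensity are Poisson distributed, and the numbers of points
in pairwise disjoint sets are independent. For a locally finite `Λ` on `ℝ^d` this determines
the law of `Φ`. -/
structure IsPoissonProcess {d : ℕ} {Ω : Type*} [MeasurableSpace Ω] (P : Measure Ω)
    (Φ : Ω → Measure (Eu d)) (Λ : Measure (Eu d)) : Prop where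
  measurable : Measurable Φ
  law : ∀ B : Set (Eu d), MeasurableSet B → Λ B ≠ ∞ →
    P.map (fun ω => Φ ω B) = (poissonMeasure (Λ B).toNNReal).map (fun k : ℕ => (k : ℝ≥0∞))
  indep : ∀ (n : ℕ) (B : Fin n → Set (Eu d)), (∀ i, MeasurableSet (B i)) →
    Pairwise (fun i j => Disjoint (B i) (B j)) → iIndepFun (fun i ω => Φ ω (B i)) P

open Classical in
/-- The point process with the points `y i ω`, `i < K ω`, counted with multiplicities, as a random
counting measure. The number `K ω` of points is random and may be infinite. -/
noncomputable def pointProcess {S Ω : Type*} [MeasurableSpace S]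
    (K : Ω → ℕ∞) (y : ℕ → Ω → S) (ω : Ω) : Measure S :=
  Measure.sum (fun i : ℕ => if (i : ℕ∞) < K ω then Measure.dirac (y i ω) else 0)

/-- The points `x i`, `i < K`, and the processes `Ξ i`, defined on the probability space `(Ω, P)`,
form the data of the particle system generated by the measure `Λ` and by the `ℝ^d`-valued process
`ξ` on `(Ω', μ)`: the `x i`, `i < K`, are the points of a Poisson process with intensity
measure `Λ`, and the `Ξ i` are independent copies of `ξ`, independent of that process. -/
structure IsGeneratedBy {d : ℕ} {Ω Ω' : Type*} [MeasurableSpace Ω] [MeasurableSpace Ω']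
    (P : Measure Ω) (K : Ω → ℕ∞) (x : ℕ → Ω → Eu d) (Ξ : ℕ → ℝ → Ω → Eu d)
    (Λ : Measure (Eu d)) (μ : Measure Ω') (ξ : ℝ → Ω' → Eu d) : Prop where
  measurable_K : Measurable K
  measurable_x : ∀ i, Measurable (x i)
  measurable_copy : ∀ i t, Measurable (Ξ i t)
  poisson : IsPoissonProcess P (pointProcess K x) Λ
  copy : ∀ i, IdentDistrib (fun ω (t : ℝ) => Ξ i t ω) (fun ω (t : ℝ) => ξ t ω) P μ
  indep_copies : iIndepFun (fun (i : ℕ) ω (t : ℝ) => Ξ i t ω) P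
  indep_points : IndepFun (fun ω => (K ω, fun i : ℕ => x i ω))
    (fun ω (i : ℕ) (t : ℝ) => Ξ i t ω) P

/-- The point process `N(t_1, …, t_n) = {(x_i + Ξ_i(t_1), …, x_i + Ξ_i(t_n))}` in `(ℝ^d)^n`. -/
noncomputable def system {d : ℕ} {Ω : Type*} (K : Ω → ℕ∞) (x : ℕ → Ω → Eu d)
    (Ξ : ℕ → ℝ → Ω → Eu d) {n : ℕ} (t : Fin n → ℝ) : Ω → Measure (Fin n → Eu d) :=
  pointProcess K (fun i ω j => x i ω + Ξ i (t j) ω)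

/-- The particle system is stationary: the point processes `N(t_1, …, t_n)` and
`N(t_1 + s, …, t_n + s)` have the same distribution. -/
def IsStationarySystem {d : ℕ} {Ω : Type*} [MeasurableSpace Ω] (P : Measure Ω)
    (K : Ω → ℕ∞) (x : ℕ → Ω → Eu d) (Ξ : ℕ → ℝ → Ω → Eu d) : Prop :=
  ∀ (n : ℕ) (t : Fin n → ℝ) (s : ℝ),
    IdentDistrib (system K x Ξ t) (system K x Ξ (fun j => t j + s)) P P

/-- A real-valued process is (strictly) stationary. -/
def IsStationaryProcess {Ω : Type*} [MeasurableSpace Ω] (μ : Measure Ω) (X : ℝ → Ω → ℝ) : Prop :=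
  ∀ (n : ℕ) (t : Fin n → ℝ) (s : ℝ),
    IdentDistrib (fun ω j => X (t j) ω) (fun ω j => X (t j + s) ω) μ μ

/-- The measure on `ℝ^d` with density `exp (-⟪l, x⟫)` with respect to Lebesgue measure. -/
noncomputable def expMeasure {d : ℕ} (l : Eu d) : Measure (Eu d) :=
  volume.withDensity (fun x => ENNReal.ofReal (Real.exp (-inner ℝ l x)))

/-- The matrix of covariances of the components of `X` with the components of `Y`. -/
noncomputable def covMatrix {d : ℕ} {Ω : Type*} [MeasurableSpace Ω] (μ : Measure Ω)
    (X Y : Ω → Eu d) : Matrix (Fin d) (Fin d) ℝ :=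
  Matrix.of (fun i j => covariance (fun ω => X ω i) (fun ω => Y ω j) μ)

/-- Wide sense stationary increments: the covariance matrix of `X(t₂) - X(t₁)` depends only on
`t₁ - t₂`. -/
def WideSenseStationaryIncrements {d : ℕ} {Ω : Type*} [MeasurableSpace Ω] (μ : Measure Ω)
    (X : ℝ → Ω → Eu d) : Prop :=
  ∃ Γ : ℝ → Matrix (Fin d) (Fin d) ℝ, ∀ t₁ t₂ : ℝ,
    covMatrix μ (fun ω => X t₂ ω - X t₁ ω) (fun ω => X t₂ ω - X t₁ ω) = Γ (t₁ - t₂)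

/-- The process `ξ` has the form `ξ(t) = W(t) - Σ(t,t) l / 2 + b(t) + c`, where
`Σ(s,t)` is the covariance matrix of `ξ(s)` and `ξ(t)`, `W` is a centred Gaussian process with
wide sense stationary increments and with variance `Σ(t,t)`, `c` is a deterministic
vector, and `b` is orthogonal to `l` and such that
`b(t₂) - b(t₁) + (Σ(t₂,t₁) - Σ(t₁,t₂)) l / 2` depends only on `t₂ - t₁`. -/
def HasExponentialForm {d : ℕ} {Ω : Type*} [MeasurableSpace Ω] (μ : Measure Ω)
    (ξ : ℝ → Ω → Eu d) (l : Eu d) : Prop :=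
  ∃ (W : ℝ → Ω → Eu d) (b : ℝ → Eu d) (c : Eu d),
    IsGaussianProcess W μ ∧
    (∀ t, ∫ ω, W t ω ∂μ = 0) ∧
    WideSenseStationaryIncrements μ W ∧
    (∀ t, covMatrix μ (W t) (W t) = covMatrix μ (ξ t) (ξ t)) ∧
    (∀ t, inner ℝ (b t) l = 0) ∧
    (∃ g : ℝ → Eu d, ∀ t₁ t₂ : ℝ,
      b t₂ - b t₁ + (1 / 2 : ℝ) • Matrix.toEuclideanLin
        (covMatrix μ (ξ t₂) (ξ t₁) - covMatrix μ (ξ t₁) (ξ t₂)) l = g (t₂ - t₁)) ∧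
    ∀ t ω, ξ t ω =
      W t ω - (1 / 2 : ℝ) • Matrix.toEuclideanLin (covMatrix μ (ξ t) (ξ t)) l + b t + c

end ParticleSystem

/-! Only the one- and two-point intensities matter. By stationarity all `Λ * P_t` equal one measure
`M`, and the two-point intensity is invariant under time shifts. Tilt it by `exp ⟪w, y_t - y_s⟫`:
the starting point cancels, and the Cameron-Martin formula turns the tilt into a translation of `M`
by the covariance of `ξ s` with the increment, times an exponential of the increment's mean and half
its variance. Comparing with the same identity after a shift by `h`, and replacing `w` by `r • w`,
shows that translating `M` along the change of covariance multiplies it by the exponential of a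
quadratic polynomial in `r`. Translations compose, so the quadratic term vanishes: increment
variances are stationary, and the multiplier is a pure exponential
(`hasTranslationExponent_incrementCov`).

The directions with an exponential multiplier form a subspace. A vector orthogonal to it would give
a stationary projection of the centred process (`shift_invariant_of_sub_diagonal`,
`eq_top_of_incrementCov_mem`), so the subspace is everything and `M` is a multiple of some
`expMeasure l`. Convolution with a Gaussian law is injective here (`eq_of_conv_map_eq`), so `Λ` is
one too. The representation of `ξ` follows from uniqueness of the multipliers and from `Λ * P_t`
being constant in `t`. -/

namespace ParticleSystem

/-! ### Uniqueness for Laplace transforms -/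

section Laplace

variable {E : Type*} [NormedAddCommGroup E] [InnerProductSpace ℝ E] [CompleteSpace E]
  [SecondCountableTopology E] [MeasurableSpace E] [BorelSpace E]

/-- A finite measure on a Hilbert space with an everywhere finite Laplace transform is determined
by that transform. -/
theorem ext_of_lintegral_exp_inner {ν₁ ν₂ : Measure E}
    (hfin : ∀ u : E, ∫⁻ x, ENNReal.ofReal (Real.exp (inner ℝ u x)) ∂ν₁ ≠ ∞)
    (h : ∀ u : E, ∫⁻ x, ENNReal.ofReal (Real.exp (inner ℝ u x)) ∂ν₁ =
      ∫⁻ x, ENNReal.ofReal (Real.exp (inner ℝ u x)) ∂ν₂) :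
    ν₁ = ν₂ := by
  have huniv : ν₁ Set.univ = ν₂ Set.univ := by simpa using h 0
  have hf₁ : IsFiniteMeasure ν₁ := ⟨by simpa [lt_top_iff_ne_top] using hfin 0⟩
  have hf₂ : IsFiniteMeasure ν₂ := ⟨huniv ▸ measure_lt_top ν₁ _⟩
  have hmeas (u : E) : Measurable fun x : E => Real.exp (inner ℝ u x) := by fun_prop
  have hint (u : E) : Integrable (fun x : E => Real.exp (inner ℝ u x)) ν₁ := by
    refine ⟨(hmeas u).aestronglyMeasurable, ?_⟩
    rw [hasFiniteIntegral_iff_ofReal (Filter.Eventually.of_forall fun x => (Real.exp_pos _).le)]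
    exact (hfin u).lt_top
  refine Measure.ext_of_charFun (funext fun t => ?_)
  have hset : integrableExpSet (fun x : E => inner ℝ t x) ν₁ = Set.univ := by
    refine Set.eq_univ_of_forall fun r => ?_
    simpa [integrableExpSet, inner_smul_left] using hint (r • t)
  have hmgf : mgf (fun x : E => inner ℝ t x) ν₁ = mgf (fun x : E => inner ℝ t x) ν₂ := by
    ext r
    have hr (ν : Measure E) : mgf (fun x : E => inner ℝ t x) ν r =
        (∫⁻ x, ENNReal.ofReal (Real.exp (inner ℝ (r • t) x)) ∂ν).toReal := by
      rw [mgf, integral_eq_lintegral_of_nonneg_ae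
        (Filter.Eventually.of_forall fun x => (Real.exp_pos _).le)
        (by fun_prop)]
      simp [inner_smul_left]
    rw [hr, hr, h]
  have hzero : ν₁ = 0 ↔ ν₂ = 0 := by
    rw [← Measure.measure_univ_eq_zero, huniv, Measure.measure_univ_eq_zero]
  -- Finiteness on the whole line makes the complex transform entire, so equality continues from the
  -- real axis to `I`, where it is the characteristic function.
  have hc := eqOn_complexMGF_of_mgf' hmgf hzero
    (show Complex.I ∈ {z : ℂ | z.re ∈ interior (integrableExpSet _ ν₁)} by simp [hset])
  simpa [complexMGF, charFun_apply, mul_comm, real_inner_comm] using hc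

end Laplace

/-! ### Exponential tilting of Gaussian laws -/

section Gaussian

variable {E Ω : Type*} [NormedAddCommGroup E] [InnerProductSpace ℝ E] [CompleteSpace E]
  [SecondCountableTopology E] [MeasurableSpace E] [BorelSpace E] [MeasurableSpace Ω]
  {μ : Measure Ω}

theorem lintegral_exp_of_hasGaussianLaw {Z : Ω → ℝ} (hZ : HasGaussianLaw Z μ) :
    ∫⁻ ω, ENNReal.ofReal (Real.exp (Z ω)) ∂μ = ENNReal.ofReal (Real.exp (μ[Z] + Var[Z; μ] / 2)) := by
  have := hZ.isProbabilityMeasure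
  have hlaw := hZ.map_eq_gaussianReal
  have hm := mgf_gaussianReal hlaw 1
  rw [Real.coe_toNNReal _ (variance_nonneg _ _)] at hm
  have hint : Integrable (fun ω => Real.exp (Z ω)) μ := by
    have := integrable_exp_mul_gaussianReal (μ := μ[Z]) (v := Var[Z; μ].toNNReal) 1
    rw [← hlaw, integrable_map_measure (by fun_prop) hZ.aemeasurable] at this
    simpa [Function.comp_def] using this
  rw [← ofReal_integral_eq_lintegral_ofReal hint
    (Filter.Eventually.of_forall fun x => (Real.exp_pos _).le)]
  simp only [mgf, one_mul, mul_one, one_pow] at hm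
  rw [hm]

/-- The Cameron-Martin formula: tilting a Gaussian law by the exponential of a jointly Gaussian
variable `Y` shifts a Gaussian vector `X` by the covariance of `X` and `Y`. -/
theorem lintegral_exp_mul_comp_of_hasGaussianLaw {X : Ω → E} {Y : Ω → ℝ}
    (hX : Measurable X) (hY : Measurable Y) (hXY : HasGaussianLaw (fun ω => (X ω, Y ω)) μ) {v : E}
    (hv : ∀ u : E, inner ℝ u v = cov[fun ω => inner ℝ u (X ω), Y; μ])
    {f : E → ℝ≥0∞} (hf : Measurable f) :
    ∫⁻ ω, ENNReal.ofReal (Real.exp (Y ω)) * f (X ω) ∂μ =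
      ENNReal.ofReal (Real.exp (μ[Y] + Var[Y; μ] / 2)) * ∫⁻ ω, f (X ω + v) ∂μ := by
  have := hXY.isProbabilityMeasure
  set C := ENNReal.ofReal (Real.exp (μ[Y] + Var[Y; μ] / 2)) with hC
  have hdens : Measurable fun ω => ENNReal.ofReal (Real.exp (Y ω)) := by fun_prop
  have hA (u : E) : HasGaussianLaw (fun ω => (inner ℝ u (X ω) : ℝ)) μ :=
    hXY.fst.map_fun (innerSL ℝ u)
  have hAY (u : E) : HasGaussianLaw (fun ω => (inner ℝ u (X ω) : ℝ) + Y ω) μ :=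
    hXY.map_fun ((innerSL ℝ u).comp (ContinuousLinearMap.fst ℝ E ℝ) +
      ContinuousLinearMap.snd ℝ E ℝ)
  -- Compare Laplace transforms: the cross term in the variance of `⟪u, X⟫ + Y` is `2 ⟪u, v⟫`, which
  -- is the effect of translating by `v`.
  have hmap : (μ.withDensity fun ω => ENNReal.ofReal (Real.exp (Y ω))).map X =
      C • μ.map (fun ω => X ω + v) := by
    have hleft (u : E) : ∫⁻ x, ENNReal.ofReal (Real.exp (inner ℝ u x))
        ∂((μ.withDensity fun ω => ENNReal.ofReal (Real.exp (Y ω))).map X) =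
        ENNReal.ofReal (Real.exp (μ[fun ω => (inner ℝ u (X ω) : ℝ) + Y ω] +
          Var[fun ω => (inner ℝ u (X ω) : ℝ) + Y ω; μ] / 2)) := by
      rw [lintegral_map (by fun_prop) hX, lintegral_withDensity_eq_lintegral_mul _ hdens
        (by fun_prop), ← lintegral_exp_of_hasGaussianLaw (hAY u)]
      refine lintegral_congr fun ω => ?_
      rw [Pi.mul_apply, ← ENNReal.ofReal_mul (Real.exp_pos _).le, ← Real.exp_add, add_comm]
    refine ext_of_lintegral_exp_inner (fun u => by rw [hleft]; exact ENNReal.ofReal_ne_top)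
      fun u => ?_
    rw [hleft, lintegral_smul_measure, lintegral_map (by fun_prop) (by fun_prop)]
    have hsplit (ω : Ω) : ENNReal.ofReal (Real.exp (inner ℝ u (X ω + v))) =
        ENNReal.ofReal (Real.exp (inner ℝ u v)) *
          ENNReal.ofReal (Real.exp (inner ℝ u (X ω))) := by
      rw [inner_add_right, Real.exp_add, ENNReal.ofReal_mul (Real.exp_pos _).le, mul_comm]
    simp_rw [hsplit]
    rw [lintegral_const_mul _ (by fun_prop), lintegral_exp_of_hasGaussianLaw (hA u), hC,
      smul_eq_mul, ← ENNReal.ofReal_mul (Real.exp_pos _).le, ← Real.exp_add,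
      ← ENNReal.ofReal_mul (Real.exp_pos _).le, ← Real.exp_add,
      integral_add (hA u).integrable hXY.snd.integrable,
      variance_fun_add (hA u).memLp_two hXY.snd.memLp_two, hv]
    congr 2
    ring
  calc ∫⁻ ω, ENNReal.ofReal (Real.exp (Y ω)) * f (X ω) ∂μ
      = ∫⁻ x, f x ∂((μ.withDensity fun ω => ENNReal.ofReal (Real.exp (Y ω))).map X) := by
        rw [lintegral_map hf hX, lintegral_withDensity_eq_lintegral_mul _ hdens
          (show Measurable fun ω => f (X ω) from hf.comp hX)]
        rfl
    _ = C * ∫⁻ ω, f (X ω + v) ∂μ := by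
        rw [hmap, lintegral_smul_measure, lintegral_map hf (by fun_prop), smul_eq_mul]

end Gaussian

/-! ### Intensity measures of the particle system -/

section Intensity

theorem lintegral_natCast_poissonMeasure (r : ℝ≥0) :
    ∫⁻ k : ℕ, (k : ℝ≥0∞) ∂(poissonMeasure r) = r := by
  have hsucc (n : ℕ) : ((n + 1 : ℕ) : ℝ≥0∞) * poissonMeasure r {n + 1} =
      r * poissonMeasure r {n} := by
    rw [poissonMeasure_singleton, poissonMeasure_singleton, ← ENNReal.ofReal_natCast,
      ← ENNReal.ofReal_coe_nnreal, ← ENNReal.ofReal_mul (by positivity),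
      ← ENNReal.ofReal_mul (by positivity)]
    congr 1
    rw [Nat.factorial_succ, pow_succ]
    push_cast
    field_simp
  have htotal : ∑' n : ℕ, poissonMeasure r {n} = 1 := by
    have h := lintegral_countable' (μ := poissonMeasure r) (fun _ => (1 : ℝ≥0∞))
    simpa using h.symm
  rw [lintegral_countable', tsum_eq_zero_add' ENNReal.summable]
  simp_rw [hsucc]
  rw [ENNReal.tsum_mul_left, htotal]
  simp

variable {d : ℕ} {Ω Ω' : Type*} [MeasurableSpace Ω] [MeasurableSpace Ω'] {P : Measure Ω}

/-- The mean measure of a Poisson process is its intensity. -/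
theorem IsPoissonProcess.bind_eq {Φ : Ω → Measure (Eu d)} {Λ : Measure (Eu d)} [SigmaFinite Λ]
    (hΦ : IsPoissonProcess P Φ Λ) : P.bind Φ = Λ := by
  have hfinite (B : Set (Eu d)) (hB : MeasurableSet B) (hΛB : Λ B ≠ ∞) : P.bind Φ B = Λ B := by
    have hev : Measurable fun ω => Φ ω B := (Measure.measurable_coe hB).comp hΦ.measurable
    rw [Measure.bind_apply hB hΦ.measurable.aemeasurable,
      ← lintegral_map (f := fun z : ℝ≥0∞ => z) measurable_id hev, hΦ.law B hB hΛB,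
      lintegral_map (f := fun z : ℝ≥0∞ => z) measurable_id Measurable.of_discrete,
      lintegral_natCast_poissonMeasure,
      ENNReal.coe_toNNReal hΛB]
  ext B hB
  -- The Poisson law is available only on sets of finite intensity, hence the exhaustion.
  have hmono : Monotone fun n => B ∩ spanningSets Λ n := fun m n hmn =>
    Set.inter_subset_inter_right _ (monotone_spanningSets Λ hmn)
  have hB' : B = ⋃ n, B ∩ spanningSets Λ n := by
    rw [← Set.inter_iUnion, iUnion_spanningSets, Set.inter_univ]
  rw [hB', hmono.measure_iUnion, hmono.measure_iUnion]
  refine iSup_congr fun n => hfinite _ (hB.inter (measurableSet_spanningSets Λ n)) ?_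
  exact ((measure_mono Set.inter_subset_right).trans_lt (measure_spanningSets_lt_top Λ n)).ne

open Classical in
theorem lintegral_pointProcess {S Ω : Type*} [MeasurableSpace S] (K : Ω → ℕ∞) (y : ℕ → Ω → S)
    (ω : Ω) {f : S → ℝ≥0∞} (hf : Measurable f) :
    ∫⁻ z, f z ∂(pointProcess K y ω) = ∑' i : ℕ, if (i : ℕ∞) < K ω then f (y i ω) else 0 := by
  rw [pointProcess, lintegral_sum_measure]
  refine tsum_congr fun i => ?_
  split_ifs
  · exact lintegral_dirac' _ hf
  · simp

variable {μ : Measure Ω'} {Λ : Measure (Eu d)} {ξ : ℝ → Ω' → Eu d} {K : Ω → ℕ∞}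
  {x : ℕ → Ω → Eu d} {Ξ : ℕ → ℝ → Ω → Eu d}

/-- The intensity measure of the finite-dimensional point process of a particle system. -/
theorem IsGeneratedBy.lintegral_bind_system [IsProbabilityMeasure P] [IsProbabilityMeasure μ]
    [SigmaFinite Λ]
    (hsys : IsGeneratedBy P K x Ξ Λ μ ξ) (hξ : ∀ t, Measurable (ξ t)) {n : ℕ} (t : Fin n → ℝ)
    (hmeas : AEMeasurable (system K x Ξ t) P) {f : (Fin n → Eu d) → ℝ≥0∞} (hf : Measurable f) :
    ∫⁻ z, f z ∂(P.bind (system K x Ξ t)) =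
      ∫⁻ z, ∫⁻ ω, f (fun j => z + ξ (t j) ω) ∂μ ∂Λ := by
  classical
  set g : Eu d → ℝ≥0∞ := fun z => ∫⁻ ω, f (fun j => z + ξ (t j) ω) ∂μ with hg
  have hK (i : ℕ) : MeasurableSet {ω | (i : ℕ∞) < K ω} :=
    hsys.measurable_K (MeasurableSet.of_discrete (s := Set.Ioi (i : ℕ∞)))
  have hx := hsys.measurable_x
  have hΞ := hsys.measurable_copy
  have hpath (i : ℕ) : Measurable fun ω (j : Fin n) => Ξ i (t j) ω := by fun_prop
  have hgm : Measurable g := by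
    refine Measurable.lintegral_prod_right' (f := fun p : Eu d × Ω' =>
      f (fun j => p.1 + ξ (t j) p.2)) (hf.comp ?_)
    exact measurable_pi_lambda _ fun j =>
      measurable_fst.add ((hξ (t j)).comp measurable_snd)
  -- Each copy is independent of `(K, x i)`, so it can be integrated out point by point; the
  -- resummed series is then an integral against the Poisson process alone.
  have hterm (i : ℕ) :
      ∫⁻ ω, (if (i : ℕ∞) < K ω then f (fun j => x i ω + Ξ i (t j) ω) else 0) ∂P =
        ∫⁻ ω, (if (i : ℕ∞) < K ω then g (x i ω) else 0) ∂P := by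
    have hind : IndepFun (fun ω => (K ω, x i ω)) (fun ω (j : Fin n) => Ξ i (t j) ω) P :=
      hsys.indep_points.comp
        (φ := fun p : ℕ∞ × (ℕ → Eu d) => (p.1, p.2 i))
        (ψ := fun (q : ℕ → ℝ → Eu d) (j : Fin n) => q i (t j)) (by fun_prop) (by fun_prop)
    have hlaw : P.map (fun ω (j : Fin n) => Ξ i (t j) ω) =
        μ.map (fun ω (j : Fin n) => ξ (t j) ω) :=
      ((hsys.copy i).comp (u := fun (q : ℝ → Eu d) (j : Fin n) => q (t j))
        (by fun_prop)).map_eq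
    have hpair : Measurable fun ω => (K ω, x i ω) := hsys.measurable_K.prodMk (hx i)
    have hprod := (indepFun_iff_map_prod_eq_prod_map_map hpair.aemeasurable
      (hpath i).aemeasurable).1 hind
    let F : (ℕ∞ × Eu d) × (Fin n → Eu d) → ℝ≥0∞ :=
      fun p => if (i : ℕ∞) < p.1.1 then f (fun j => p.1.2 + p.2 j) else 0
    have hF : Measurable F := by
      refine Measurable.ite ?_ (hf.comp (by fun_prop)) measurable_const
      exact (measurable_fst.comp measurable_fst)
        (MeasurableSet.of_discrete (s := Set.Ioi (i : ℕ∞)))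
    calc ∫⁻ ω, (if (i : ℕ∞) < K ω then f (fun j => x i ω + Ξ i (t j) ω) else 0) ∂P
        = ∫⁻ p, F p ∂(P.map fun ω => ((K ω, x i ω), fun j : Fin n => Ξ i (t j) ω)) := by
          rw [lintegral_map hF (hpair.prodMk (hpath i))]
      _ = ∫⁻ ω, ∫⁻ ω', F ((K ω, x i ω), fun j => ξ (t j) ω') ∂μ ∂P := by
          have : IsProbabilityMeasure (μ.map (fun ω (j : Fin n) => ξ (t j) ω)) :=
            Measure.isProbabilityMeasure_map (by fun_prop)
          rw [hprod, hlaw, lintegral_prod _ hF.aemeasurable,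
            lintegral_map hF.lintegral_prod_right' hpair]
          refine lintegral_congr fun ω => ?_
          rw [lintegral_map (by fun_prop) (by fun_prop)]
      _ = ∫⁻ ω, (if (i : ℕ∞) < K ω then g (x i ω) else 0) ∂P := by
          refine lintegral_congr fun ω => ?_
          by_cases h : (i : ℕ∞) < K ω <;> simp [F, g, h]
  have hΦ := hsys.poisson.measurable
  calc ∫⁻ z, f z ∂(P.bind (system K x Ξ t))
      = ∫⁻ ω, ∑' i : ℕ, (if (i : ℕ∞) < K ω then f (fun j => x i ω + Ξ i (t j) ω) else 0) ∂P := by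
        rw [Measure.lintegral_bind hmeas hf.aemeasurable]
        exact lintegral_congr fun ω => lintegral_pointProcess K _ ω hf
    _ = ∑' i : ℕ, ∫⁻ ω, (if (i : ℕ∞) < K ω then f (fun j => x i ω + Ξ i (t j) ω) else 0) ∂P :=
        lintegral_tsum fun i => (Measurable.ite (hK i) (hf.comp (by fun_prop))
          measurable_const).aemeasurable
    _ = ∑' i : ℕ, ∫⁻ ω, (if (i : ℕ∞) < K ω then g (x i ω) else 0) ∂P := tsum_congr hterm
    _ = ∫⁻ ω, ∑' i : ℕ, (if (i : ℕ∞) < K ω then g (x i ω) else 0) ∂P :=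
        (lintegral_tsum fun i => (Measurable.ite (hK i) (hgm.comp (hx i))
          measurable_const).aemeasurable).symm
    _ = ∫⁻ z, g z ∂(P.bind (pointProcess K x)) := by
        rw [Measure.lintegral_bind hΦ.aemeasurable hgm.aemeasurable]
        exact lintegral_congr fun ω => (lintegral_pointProcess K x ω hgm).symm
    _ = ∫⁻ z, g z ∂Λ := by rw [hsys.poisson.bind_eq]

/-- The two-point intensities of a stationary particle system are invariant under time shifts. -/
theorem IsStationarySystem.lintegral_pair_shift [IsProbabilityMeasure P] [IsProbabilityMeasure μ]
    [SigmaFinite Λ]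
    (hstat : IsStationarySystem P K x Ξ) (hsys : IsGeneratedBy P K x Ξ Λ μ ξ)
    (hξ : ∀ t, Measurable (ξ t)) (s t h : ℝ) {f : Eu d × Eu d → ℝ≥0∞} (hf : Measurable f) :
    ∫⁻ z, ∫⁻ ω, f (z + ξ s ω, z + ξ t ω) ∂μ ∂Λ =
      ∫⁻ z, ∫⁻ ω, f (z + ξ (s + h) ω, z + ξ (t + h) ω) ∂μ ∂Λ := by
  have hid := hstat 2 ![s, t] h
  have hbind : P.bind (system K x Ξ ![s, t]) =
      P.bind (system K x Ξ fun j => ![s, t] j + h) := by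
    rw [Measure.bind, Measure.bind, hid.map_eq]
  have hF : Measurable fun y : Fin 2 → Eu d => f (y 0, y 1) := by fun_prop
  have h₁ := hsys.lintegral_bind_system hξ ![s, t] hid.aemeasurable_fst hF
  have h₂ := hsys.lintegral_bind_system hξ (fun j => ![s, t] j + h) hid.aemeasurable_snd hF
  rw [hbind, h₂] at h₁
  simpa using h₁.symm

end Intensity

/-! ### Measures multiplied by a factor under translation -/

section Exponential

variable {d : ℕ}

theorem lintegral_expMeasure (l : Eu d) {f : Eu d → ℝ≥0∞} (hf : Measurable f) :
    ∫⁻ x, f x ∂(expMeasure l) = ∫⁻ x, ENNReal.ofReal (Real.exp (-inner ℝ l x)) * f x := by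
  rw [expMeasure, lintegral_withDensity_eq_lintegral_mul _ (by fun_prop) hf]
  rfl

theorem map_add_right_expMeasure (l v : Eu d) :
    (expMeasure l).map (· + v) = ENNReal.ofReal (Real.exp (inner ℝ l v)) • expMeasure l := by
  refine Measure.ext_of_lintegral _ fun f hf => ?_
  rw [lintegral_map hf (by fun_prop), lintegral_smul_measure, lintegral_expMeasure l (by fun_prop),
    lintegral_expMeasure l hf, smul_eq_mul, ← lintegral_const_mul _ (by fun_prop),
    ← lintegral_add_right_eq_self
      (fun x => ENNReal.ofReal (Real.exp (inner ℝ l v)) *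
        (ENNReal.ofReal (Real.exp (-inner ℝ l x)) * f x)) v]
  refine lintegral_congr fun x => ?_
  rw [← mul_assoc, ← ENNReal.ofReal_mul (Real.exp_pos _).le, ← Real.exp_add, inner_add_right]
  congr 3
  ring

variable {M : Measure (Eu d)}

/-- Some set has finite positive mass, and the factors can be compared there. -/
theorem eq_of_ofReal_exp_smul_eq [IsLocallyFiniteMeasure M] (hM : M ≠ 0) {a b : ℝ}
    (h : ENNReal.ofReal (Real.exp a) • M = ENNReal.ofReal (Real.exp b) • M) : a = b := by
  obtain ⟨n, hn⟩ : ∃ n, M (spanningSets M n) ≠ 0 := by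
    by_contra! hall
    refine hM (Measure.measure_univ_eq_zero.1 ?_)
    rw [← iUnion_spanningSets M]
    exact measure_iUnion_null hall
  have hB := congrArg (fun ν : Measure (Eu d) => ν (spanningSets M n)) h
  simp only [Measure.smul_apply, smul_eq_mul] at hB
  rw [ENNReal.mul_left_inj hn (measure_spanningSets_lt_top M n).ne,
    ENNReal.ofReal_eq_ofReal_iff (Real.exp_pos _).le (Real.exp_pos _).le] at hB
  exact Real.exp_injective hB

/-- The measure `M` is multiplied by `exp (r * k)` under translation by `r • v`. -/
def HasTranslationExponent (M : Measure (Eu d)) (v : Eu d) (k : ℝ) : Prop :=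
  ∀ r : ℝ, M.map (· + r • v) = ENNReal.ofReal (Real.exp (r * k)) • M

theorem HasTranslationExponent.add {v w : Eu d} {k k' : ℝ} (hv : HasTranslationExponent M v k)
    (hw : HasTranslationExponent M w k') : HasTranslationExponent M (v + w) (k + k') := by
  intro r
  have hcomp : (fun x : Eu d => x + r • (v + w)) = (· + r • w) ∘ (· + r • v) := by
    ext1 x
    simp [smul_add, add_assoc]
  rw [hcomp, ← Measure.map_map (by fun_prop) (by fun_prop), hv r, Measure.map_smul, hw r, smul_smul,
    ← ENNReal.ofReal_mul (Real.exp_pos _).le, ← Real.exp_add, ← mul_add]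

theorem HasTranslationExponent.smul {v : Eu d} {k : ℝ} (hv : HasTranslationExponent M v k)
    (a : ℝ) : HasTranslationExponent M (a • v) (a * k) := by
  intro r
  rw [smul_smul, hv, mul_assoc]

theorem HasTranslationExponent.zero : HasTranslationExponent M 0 0 := by
  intro r
  simp

theorem HasTranslationExponent.unique [IsLocallyFiniteMeasure M] (hM : M ≠ 0) {v : Eu d} {k k' : ℝ}
    (h : HasTranslationExponent M v k) (h' : HasTranslationExponent M v k') : k = k' := by
  have := (h 1).symm.trans (h' 1)
  simpa using eq_of_ofReal_exp_smul_eq hM this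

/-- A translation by `v` for which the multiplier is the exponential of a quadratic function of
the length of `v` has an exponential multiplier. -/
theorem HasTranslationExponent.of_quadratic [IsLocallyFiniteMeasure M] (hM : M ≠ 0) {v : Eu d} {a b : ℝ}
    (h : ∀ r : ℝ, M.map (· + r • v) = ENNReal.ofReal (Real.exp (r * a + r ^ 2 * b)) • M) :
    b = 0 ∧ HasTranslationExponent M v a := by
  -- Translating by `2 • v` at once gives the exponent `2a + 4b`, translating twice by `v` gives `2a
  -- + 2b`.
  have hb : b = 0 := by
    have hcomp : (fun x : Eu d => x + (2 : ℝ) • v) = (· + (1 : ℝ) • v) ∘ (· + (1 : ℝ) • v) := by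
      ext1 x
      simp [two_smul, add_assoc]
    have h2 := h 2
    rw [hcomp, ← Measure.map_map (by fun_prop) (by fun_prop), h 1, Measure.map_smul, h 1, smul_smul,
      ← ENNReal.ofReal_mul (Real.exp_pos _).le, ← Real.exp_add] at h2
    linarith [eq_of_ofReal_exp_smul_eq hM h2]
  exact ⟨hb, fun r => by simpa [hb] using h r⟩

/-- A locally finite measure which every translation multiplies by an exponential factor is a
multiple of an exponential measure. -/
theorem exists_eq_smul_expMeasure [IsLocallyFiniteMeasure M] (hM : M ≠ 0)
    (h : ∀ v, ∃ k, HasTranslationExponent M v k) :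
    ∃ (c : ℝ≥0) (l : Eu d), 0 < c ∧ M = c • expMeasure l := by
  choose k hk using h
  -- Uniqueness of the exponent makes it linear in the direction, and Riesz representation supplies
  -- `l`.
  let κ : Eu d →ₗ[ℝ] ℝ :=
    { toFun := k
      map_add' := fun v w => (hk (v + w)).unique hM ((hk v).add (hk w))
      map_smul' := fun a v => (hk (a • v)).unique hM ((hk v).smul a) }
  set l : Eu d := (InnerProductSpace.toDual ℝ (Eu d)).symm κ.toContinuousLinearMap with hl
  have hkl (v : Eu d) : k v = inner ℝ l v := by
    rw [hl, InnerProductSpace.toDual_symm_apply]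
    rfl
  have hdens : Measurable fun y : Eu d => ENNReal.ofReal (Real.exp (inner ℝ l y)) := by fun_prop
  -- This density cancels the multipliers, so `M'` is translation invariant, hence a multiple of
  -- Lebesgue measure.
  set M' := M.withDensity fun y => ENNReal.ofReal (Real.exp (inner ℝ l y)) with hM'
  have hloc : IsLocallyFiniteMeasure M' :=
    IsLocallyFiniteMeasure.withDensity_ofReal (by fun_prop)
  have hinv : M'.IsAddLeftInvariant := by
    refine ⟨fun v => Measure.ext_of_lintegral _ fun f hf => ?_⟩
    have hv := hk v 1
    simp only [one_smul, one_mul] at hv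
    calc ∫⁻ y, f y ∂(M'.map (v + ·))
        = ∫⁻ y, ENNReal.ofReal (Real.exp (inner ℝ l y)) * f (y + v) ∂M := by
          rw [lintegral_map hf (by fun_prop), hM',
            lintegral_withDensity_eq_lintegral_mul _ hdens (by fun_prop)]
          simp [add_comm]
      _ = ∫⁻ y, ENNReal.ofReal (Real.exp (-inner ℝ l v)) *
            (ENNReal.ofReal (Real.exp (inner ℝ l (y + v))) * f (y + v)) ∂M := by
          refine lintegral_congr fun y => ?_
          rw [← mul_assoc, ← ENNReal.ofReal_mul (Real.exp_pos _).le, ← Real.exp_add,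
            inner_add_right]
          congr 3
          ring
      _ = ENNReal.ofReal (Real.exp (-inner ℝ l v)) *
            ∫⁻ y, ENNReal.ofReal (Real.exp (inner ℝ l y)) * f y ∂(M.map (· + v)) := by
          rw [lintegral_const_mul _ (by fun_prop), lintegral_map (by fun_prop) (by fun_prop)]
      _ = ∫⁻ y, ENNReal.ofReal (Real.exp (inner ℝ l y)) * f y ∂M := by
          rw [hv, lintegral_smul_measure, smul_eq_mul, ← mul_assoc,
            ← ENNReal.ofReal_mul (Real.exp_pos _).le, ← Real.exp_add, hkl]
          simp
      _ = ∫⁻ y, f y ∂M' := by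
          rw [hM', lintegral_withDensity_eq_lintegral_mul _ hdens hf]
          rfl
  have hhaar := Measure.isAddLeftInvariant_eq_smul M' (volume : Measure (Eu d))
  set c := Measure.addHaarScalarFactor M' (volume : Measure (Eu d))
  have hMc : M = c • expMeasure l := by
    have hback : M'.withDensity (fun y => ENNReal.ofReal (Real.exp (-inner ℝ l y))) = M := by
      rw [hM', ← withDensity_mul _ hdens (by fun_prop)]
      have : ((fun y : Eu d => ENNReal.ofReal (Real.exp (inner ℝ l y))) *
          fun y => ENNReal.ofReal (Real.exp (-inner ℝ l y))) = 1 := by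
        ext1 y
        rw [Pi.mul_apply, ← ENNReal.ofReal_mul (Real.exp_pos _).le, ← Real.exp_add]
        simp
      rw [this, withDensity_one]
    rw [← hback, hhaar, expMeasure]
    exact withDensity_smul_measure _ _
  refine ⟨c, l, pos_iff_ne_zero.2 fun hc => hM ?_, hMc⟩
  rw [hMc, hc, zero_smul]

end Exponential

/-! ### Covariance matrices as bilinear forms -/

section Covariance

variable {d : ℕ} {Ω : Type*} [MeasurableSpace Ω] {μ : Measure Ω} {X Y : Ω → Eu d}

theorem memLp_apply {X : Ω → Eu d} (hX : MemLp X 2 μ) (i : Fin d) :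
    MemLp (fun ω => X ω i) 2 μ :=
  (EuclideanSpace.proj (𝕜 := ℝ) i).comp_memLp' hX

/-- The covariance matrix represents the covariances of linear functionals. -/
theorem inner_toEuclideanLin_covMatrix [IsProbabilityMeasure μ] (hX : MemLp X 2 μ)
    (hY : MemLp Y 2 μ) (u w : Eu d) :
    inner ℝ u (Matrix.toEuclideanLin (covMatrix μ X Y) w) =
      cov[fun ω => inner ℝ u (X ω), fun ω => inner ℝ w (Y ω); μ] := by
  have hsum (u : Eu d) (Z : Ω → Eu d) :
      (fun ω => (inner ℝ u (Z ω) : ℝ)) = fun ω => ∑ i, u i * Z ω i := by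
    ext ω
    simp [PiLp.inner_apply, mul_comm]
  rw [hsum u X, hsum w Y, covariance_fun_sum_fun_sum
    (fun i => (memLp_apply hX i).const_mul _) (fun i => (memLp_apply hY i).const_mul _)]
  simp only [covariance_const_mul_left, covariance_const_mul_right]
  simp only [PiLp.inner_apply, Matrix.toLpLin_apply, Matrix.mulVec, dotProduct, covMatrix,
    Matrix.of_apply, RCLike.inner_apply, conj_trivial, Finset.sum_mul]
  refine Finset.sum_congr rfl fun i _ => Finset.sum_congr rfl fun j _ => ?_
  ring

theorem inner_toEuclideanLin_covMatrix_comm [IsProbabilityMeasure μ] (hX : MemLp X 2 μ)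
    (hY : MemLp Y 2 μ) (u w : Eu d) :
    inner ℝ u (Matrix.toEuclideanLin (covMatrix μ X Y) w) =
      inner ℝ w (Matrix.toEuclideanLin (covMatrix μ Y X) u) := by
  rw [inner_toEuclideanLin_covMatrix hX hY, inner_toEuclideanLin_covMatrix hY hX, covariance_comm]

/-- A covariance matrix is determined by the variances of linear functionals. -/
theorem covMatrix_self_eq_of_variance_inner_eq [IsProbabilityMeasure μ] (hX : MemLp X 2 μ)
    (hY : MemLp Y 2 μ)
    (h : ∀ w : Eu d, Var[fun ω => inner ℝ w (X ω); μ] = Var[fun ω => inner ℝ w (Y ω); μ]) :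
    covMatrix μ X X = covMatrix μ Y Y := by
  have hpol {Z : Ω → Eu d} (hZ : MemLp Z 2 μ) (i j : Fin d) :
      2 * cov[fun ω => Z ω i, fun ω => Z ω j; μ] =
        Var[fun ω => inner ℝ (EuclideanSpace.single i (1 : ℝ) + EuclideanSpace.single j 1) (Z ω); μ]
        - Var[fun ω => inner ℝ (EuclideanSpace.single i (1 : ℝ)) (Z ω); μ]
        - Var[fun ω => inner ℝ (EuclideanSpace.single j (1 : ℝ)) (Z ω); μ] := by
    simp only [inner_add_left, EuclideanSpace.inner_single_left, map_one, one_mul]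
    rw [variance_fun_add (memLp_apply hZ i) (memLp_apply hZ j)]
    ring
  ext i j
  have h₁ := hpol hX i j
  rw [h, h, h, ← hpol hY i j] at h₁
  simpa [covMatrix] using h₁

theorem covMatrix_sub_const [IsProbabilityMeasure μ] (hX : MemLp X 2 μ) (hY : MemLp Y 2 μ)
    (a b : Eu d) : covMatrix μ (fun ω => X ω - a) (fun ω => Y ω - b) = covMatrix μ X Y := by
  ext i j
  simp only [covMatrix, Matrix.of_apply, PiLp.sub_apply]
  rw [covariance_sub_const_left ((memLp_apply hX i).integrable one_le_two),
    covariance_sub_const_right ((memLp_apply hY j).integrable one_le_two)]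

end Covariance

/-! ### Convolution with Gaussian laws -/

section Convolution

variable {d : ℕ} {Ω : Type*} [MeasurableSpace Ω] {μ : Measure Ω} {X : Ω → Eu d}

theorem lintegral_conv_map [IsFiniteMeasure μ] (hX : Measurable X) (Λ : Measure (Eu d))
    {f : Eu d → ℝ≥0∞} (hf : Measurable f) :
    ∫⁻ y, f y ∂(Measure.conv Λ (μ.map X)) = ∫⁻ z, ∫⁻ ω, f (z + X ω) ∂μ ∂Λ := by
  rw [Measure.lintegral_conv hf]
  refine lintegral_congr fun z => ?_
  rw [lintegral_map (by fun_prop) hX]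

/-- A ball of radius `1` plus a ball of radius `n` charged by `ν` lies in a ball of radius `1 + n`,
which has finite mass for the convolution. -/
theorem isLocallyFiniteMeasure_of_conv {Λ ν : Measure (Eu d)} [IsProbabilityMeasure ν]
    [IsLocallyFiniteMeasure (Measure.conv Λ ν)] : IsLocallyFiniteMeasure Λ := by
  obtain ⟨n, hn⟩ : ∃ n : ℕ, ν (Metric.closedBall 0 n) ≠ 0 := by
    by_contra! hall
    have huniv : ν Set.univ = 0 := by
      rw [← Metric.iUnion_closedBall_nat (0 : Eu d)]
      exact measure_iUnion_null hall
    simp at huniv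
  refine ⟨fun x => ⟨Metric.closedBall x 1, Metric.closedBall_mem_nhds x one_pos, ?_⟩⟩
  have hfin : Measure.conv Λ ν (Metric.closedBall x (1 + n)) < ∞ :=
    (isCompact_closedBall x _).measure_lt_top
  have hle : Λ (Metric.closedBall x 1) * ν (Metric.closedBall 0 n) ≤
      Measure.conv Λ ν (Metric.closedBall x (1 + n)) := by
    have hball : MeasurableSet (Metric.closedBall x (1 + n : ℝ)) := measurableSet_closedBall
    rw [← lintegral_indicator_one hball, Measure.lintegral_conv (measurable_one.indicator hball)]
    calc Λ (Metric.closedBall x 1) * ν (Metric.closedBall 0 n)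
        = ∫⁻ _ in Metric.closedBall x 1, ν (Metric.closedBall 0 n) ∂Λ := by
          rw [setLIntegral_const, mul_comm]
      _ ≤ ∫⁻ z in Metric.closedBall x 1, ∫⁻ y,
            (Metric.closedBall x (1 + n : ℝ)).indicator 1 (z + y) ∂ν ∂Λ := by
          refine setLIntegral_mono' measurableSet_closedBall fun z hz => ?_
          rw [← lintegral_indicator_one measurableSet_closedBall]
          refine lintegral_mono fun y => ?_
          by_cases hy : y ∈ Metric.closedBall (0 : Eu d) n
          · have hzy : z + y ∈ Metric.closedBall x (1 + n : ℝ) := by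
              rw [mem_closedBall_iff_norm] at hz ⊢
              rw [mem_closedBall_zero_iff] at hy
              calc ‖z + y - x‖ = ‖(z - x) + y‖ := by congr 1; abel
                _ ≤ 1 + n := (norm_add_le _ _).trans (add_le_add hz hy)
            rw [Set.indicator_of_mem hzy, Set.indicator_of_mem hy, Pi.one_apply, Pi.one_apply]
          · rw [Set.indicator_of_notMem hy]
            exact zero_le
      _ ≤ _ := setLIntegral_le_lintegral _ _
  refine lt_top_iff_ne_top.2 fun htop => ?_
  rw [htop, ENNReal.top_mul hn] at hle
  exact hfin.not_ge hle

/-- Convolution with a Gaussian law is injective on measures for which the Gaussian-damped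
exponential moments of the convolution are finite. -/
theorem eq_of_conv_map_eq [IsProbabilityMeasure μ] (hX : Measurable X) (hG : HasGaussianLaw X μ)
    {Λ Λ' : Measure (Eu d)}
    (hfin : ∀ u a : Eu d, ∫⁻ y, ENNReal.ofReal (Real.exp (inner ℝ u y)) *
      ENNReal.ofReal (Real.exp (-‖y - a‖ ^ 2)) ∂(Measure.conv Λ (μ.map X)) ≠ ∞)
    (h : Measure.conv Λ (μ.map X) = Measure.conv Λ' (μ.map X)) : Λ = Λ' := by
  -- The measures may lack exponential moments, so a Gaussian weight is inserted. Its average `H` is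
  -- positive and finite, so `Λ` can be recovered from `Λ.withDensity H`.
  set φ : Eu d → ℝ≥0∞ := fun y => ENNReal.ofReal (Real.exp (-‖y‖ ^ 2)) with hφ
  have hφm : Measurable φ := by fun_prop
  set H : Eu d → ℝ≥0∞ := fun z => ∫⁻ ω, φ (z + X ω) ∂μ with hH
  have hHm : Measurable H :=
    Measurable.lintegral_prod_right' (f := fun p : Eu d × Ω => φ (p.1 + X p.2)) (by fun_prop)
  have hH0 (z : Eu d) : H z ≠ 0 := by
    rw [hH, ← pos_iff_ne_zero]
    refine (lintegral_pos_iff_support (by fun_prop)).2 ?_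
    have : (Function.support fun ω => φ (z + X ω)) = Set.univ :=
      Set.eq_univ_of_forall fun ω => by simp [φ, Real.exp_pos]
    simp [this]
  have hHtop (z : Eu d) : H z ≠ ∞ := by
    refine ne_top_of_le_ne_top ENNReal.one_ne_top ?_
    calc H z ≤ ∫⁻ _, 1 ∂μ := lintegral_mono fun ω => by
          simp [φ, ENNReal.ofReal_le_one, Real.exp_le_one_iff]
      _ = 1 := by simp
  -- The tilt by `⟪u, X⟫` shifts `X` by its covariance operator at `u`. Centring the weight at this
  -- same `v` cancels the shift, so the same `H` appears for every `u`.
  have hmoment (u : Eu d) : ∃ (v : Eu d) (C : ℝ≥0∞), C ≠ 0 ∧ C ≠ ∞ ∧ ∀ L : Measure (Eu d),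
      ∫⁻ y, ENNReal.ofReal (Real.exp (inner ℝ u y)) * φ (y - v) ∂(Measure.conv L (μ.map X)) =
        C * ∫⁻ z, ENNReal.ofReal (Real.exp (inner ℝ u z)) ∂(L.withDensity H) := by
    refine ⟨Matrix.toEuclideanLin (covMatrix μ X X) u,
      ENNReal.ofReal (Real.exp (μ[fun ω => (inner ℝ u (X ω) : ℝ)] +
        Var[fun ω => inner ℝ u (X ω); μ] / 2)), by simp [Real.exp_pos], ENNReal.ofReal_ne_top,
      fun L => ?_⟩
    rw [lintegral_conv_map hX L (by fun_prop), lintegral_withDensity_eq_lintegral_mul _ hHm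
      (by fun_prop), ← lintegral_const_mul _ (by fun_prop)]
    refine lintegral_congr fun z => ?_
    have hpair : HasGaussianLaw (fun ω => (X ω, (inner ℝ u (X ω) : ℝ))) μ :=
      hG.map_fun ((ContinuousLinearMap.id ℝ (Eu d)).prod (innerSL ℝ u))
    have hcm := lintegral_exp_mul_comp_of_hasGaussianLaw hX (by fun_prop) hpair
      (fun w => inner_toEuclideanLin_covMatrix hG.memLp_two hG.memLp_two w u)
      (f := fun y => φ (z + y - Matrix.toEuclideanLin (covMatrix μ X X) u)) (by fun_prop)
    calc ∫⁻ ω, ENNReal.ofReal (Real.exp (inner ℝ u (z + X ω))) *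
          φ (z + X ω - Matrix.toEuclideanLin (covMatrix μ X X) u) ∂μ
        = ENNReal.ofReal (Real.exp (inner ℝ u z)) *
          ∫⁻ ω, ENNReal.ofReal (Real.exp (inner ℝ u (X ω))) *
            φ (z + X ω - Matrix.toEuclideanLin (covMatrix μ X X) u) ∂μ := by
          rw [← lintegral_const_mul _ (by fun_prop)]
          refine lintegral_congr fun ω => ?_
          rw [inner_add_right, Real.exp_add, ENNReal.ofReal_mul (Real.exp_pos _).le, mul_assoc]
      _ = _ := by
          rw [hcm, Pi.mul_apply, hH]
          simp only [← add_assoc, add_sub_cancel_right]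
          ring
  have hdens : Λ.withDensity H = Λ'.withDensity H := by
    refine ext_of_lintegral_exp_inner (fun u htop => ?_) fun u => ?_
    · obtain ⟨v, C, hC0, -, hC⟩ := hmoment u
      refine hfin u v ?_
      have := hC Λ
      rw [htop, ENNReal.mul_top hC0] at this
      exact this
    · obtain ⟨v, C, hC0, hCtop, hC⟩ := hmoment u
      refine (ENNReal.mul_right_inj hC0 hCtop).1 ?_
      rw [← hC Λ, ← hC Λ', h]
  rw [← withDensity_inv_same hHm (μ := Λ) (Filter.Eventually.of_forall hH0)
      (Filter.Eventually.of_forall hHtop), hdens,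
    withDensity_inv_same hHm (Filter.Eventually.of_forall hH0)
      (Filter.Eventually.of_forall hHtop)]

/-- Every translate of `expMeasure l` is a multiple of it; averaging the factor gives the Laplace
transform of `X` at `l`. -/
theorem conv_smul_expMeasure [IsProbabilityMeasure μ] (hX : Measurable X)
    (hG : HasGaussianLaw X μ) (c : ℝ≥0) (l : Eu d) :
    Measure.conv (c • expMeasure l) (μ.map X) =
      ENNReal.ofReal (Real.exp (inner ℝ l (∫ ω, X ω ∂μ) + Var[fun ω => inner ℝ l (X ω); μ] / 2)) •
        c • expMeasure l := by
  have hsf : SFinite (expMeasure l) := by unfold expMeasure; infer_instance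
  refine Measure.ext_of_lintegral _ fun f hf => ?_
  have hexp := lintegral_exp_of_hasGaussianLaw (hG.map_fun (innerSL ℝ l))
  simp only [innerSL_apply_apply] at hexp
  rw [integral_inner hG.integrable] at hexp
  rw [lintegral_conv_map hX _ hf, lintegral_lintegral_swap (by fun_prop), lintegral_smul_measure,
    ← hexp, smul_eq_mul, ← lintegral_mul_const _ (by fun_prop)]
  refine lintegral_congr fun ω => ?_
  rw [← lintegral_map (f := f) (g := (· + X ω)) hf (by fun_prop), Measure.map_smul,
    map_add_right_expMeasure, smul_comm, lintegral_smul_measure, smul_eq_mul]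

theorem lintegral_exp_mul_gaussian_expMeasure_ne_top (c : ℝ≥0) (l u a : Eu d) :
    ∫⁻ y, ENNReal.ofReal (Real.exp (inner ℝ u y)) * ENNReal.ofReal (Real.exp (-‖y - a‖ ^ 2))
      ∂(c • expMeasure l) ≠ ∞ := by
  rw [lintegral_smul_measure, lintegral_expMeasure l (by fun_prop)]
  refine ENNReal.mul_ne_top ENNReal.coe_ne_top ?_
  -- Expanding `‖y - a‖ ^ 2` collects the linear terms into `u - l + 2 • a`.
  have hint := (GaussianFourier.integrable_cexp_neg_mul_sq_norm_add (V := Eu d) (b := 1) (by simp) 1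
    (u - l + (2 : ℝ) • a)).norm.const_mul (Real.exp (-‖a‖ ^ 2))
  have heq (y : Eu d) : ENNReal.ofReal (Real.exp (-inner ℝ l y)) *
      (ENNReal.ofReal (Real.exp (inner ℝ u y)) * ENNReal.ofReal (Real.exp (-‖y - a‖ ^ 2))) =
      ENNReal.ofReal (Real.exp (-‖a‖ ^ 2) *
        ‖Complex.exp (-1 * (‖y‖ : ℂ) ^ 2 + 1 * ((inner ℝ (u - l + (2 : ℝ) • a) y : ℝ) : ℂ))‖) := by
    rw [← ENNReal.ofReal_mul (Real.exp_pos _).le, ← ENNReal.ofReal_mul (Real.exp_pos _).le,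
      ← Real.exp_add, ← Real.exp_add, Complex.norm_exp, ← Real.exp_add, norm_sub_sq_real]
    congr 2
    have : (-1 * (‖y‖ : ℂ) ^ 2 + 1 * ((inner ℝ (u - l + (2 : ℝ) • a) y : ℝ) : ℂ)).re =
        -‖y‖ ^ 2 + inner ℝ (u - l + (2 : ℝ) • a) y := by
      rw [← Complex.ofReal_re (-‖y‖ ^ 2 + inner ℝ (u - l + (2 : ℝ) • a) y)]
      congr 1
      push_cast
      ring
    rw [this, inner_add_left, inner_sub_left, inner_smul_left, real_inner_comm y a]
    simp
    ring
  simp_rw [heq]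
  exact hint.lintegral_lt_top.ne

end Convolution

/-! ### Stationarity from covariances -/

section Stationarity

/-- Exchanging `s` and `t` and subtracting shows that differences of diagonal values are shift
invariant. So `C (n t) (n t)` is affine in `n`, and nonnegativity forbids a negative slope. The
slopes for `t` and `-t` are opposite, so the diagonal is constant. -/
theorem shift_invariant_of_sub_diagonal {C : ℝ → ℝ → ℝ} (hsymm : ∀ s t, C s t = C t s)
    (hnonneg : ∀ t, 0 ≤ C t t)
    (h : ∀ s t r, C s t - C s s = C (s + r) (t + r) - C (s + r) (s + r)) (s t r : ℝ) :
    C s t = C (s + r) (t + r) := by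
  have hdiag (s t r : ℝ) : C t t - C s s = C (t + r) (t + r) - C (s + r) (s + r) := by
    have h₁ := h s t r
    have h₂ := h t s r
    rw [hsymm t s, hsymm (t + r)] at h₂
    linarith
  have hmul (t : ℝ) (n : ℕ) : C (n * t) (n * t) = C 0 0 + n * (C t t - C 0 0) := by
    induction n with
    | zero => simp
    | succ n ih =>
      have := hdiag 0 t (n * t)
      rw [zero_add, ih] at this
      push_cast
      rw [show ((n : ℝ) + 1) * t = t + n * t by ring]
      linarith
  have hge (t : ℝ) : C 0 0 ≤ C t t := by
    by_contra! hlt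
    obtain ⟨n, hn⟩ := exists_nat_gt (C 0 0 / (C 0 0 - C t t))
    rw [div_lt_iff₀ (by linarith)] at hn
    have := hnonneg (n * t)
    rw [hmul] at this
    linarith
  have hconst (t : ℝ) : C t t = C 0 0 := by
    have := hdiag 0 t (-t)
    rw [add_neg_cancel, zero_add] at this
    linarith [hge t, hge (-t)]
  have := h s t r
  rw [hconst s, hconst (s + r)] at this
  linarith

variable {Ω : Type*} [MeasurableSpace Ω] {μ : Measure Ω} {X : ℝ → Ω → ℝ}

/-- A centred real Gaussian process with shift-invariant covariance function is stationary. -/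
theorem isStationaryProcess_of_covariance (hX : IsGaussianProcess X μ) (hmean : ∀ t, μ[X t] = 0)
    (hcov : ∀ s t r, cov[X s, X t; μ] = cov[X (s + r), X (t + r); μ]) :
    IsStationaryProcess μ X := by
  have := hX.isProbabilityMeasure
  intro n t r
  have hlaw (t : Fin n → ℝ) : HasGaussianLaw (fun ω j => X (t j) ω) μ :=
    ((hX.comp_right t).hasGaussianLaw Finset.univ).map_fun
      (ContinuousLinearMap.pi fun j : Fin n => ContinuousLinearMap.proj
        (⟨j, Finset.mem_univ j⟩ : (Finset.univ : Finset (Fin n))))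
  have hmem (t : ℝ) : MemLp (X t) 2 μ := (hX.hasGaussianLaw_eval t).memLp_two
  refine ⟨(hlaw t).aemeasurable, (hlaw _).aemeasurable, ?_⟩
  have hfin (t : Fin n → ℝ) : IsProbabilityMeasure (μ.map fun ω j => X (t j) ω) :=
    Measure.isProbabilityMeasure_map (hlaw t).aemeasurable
  have := hfin t
  have := hfin fun j => t j + r
  refine Measure.ext_of_charFunDual (funext fun L => ?_)
  have hL (t : Fin n → ℝ) : (fun ω => L fun j => X (t j) ω) =
      fun ω => ∑ j, L (Pi.single j 1) * X (t j) ω := by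
    ext ω
    rw [← ContinuousLinearMap.coe_coe, LinearMap.pi_apply_eq_sum_univ]
    refine Finset.sum_congr rfl fun j _ => ?_
    rw [smul_eq_mul, mul_comm, ContinuousLinearMap.coe_coe]
    congr 2
    ext i
    simp [Pi.single_apply, eq_comm]
  have hm (t : Fin n → ℝ) : ∫ ω, (L fun j => X (t j) ω) ∂μ = 0 := by
    rw [hL, integral_finsetSum _ fun j _ => ((hmem (t j)).integrable one_le_two).const_mul _]
    simp [integral_const_mul, hmean]
  have hv (t : Fin n → ℝ) : Var[fun ω => L fun j => X (t j) ω; μ] =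
      ∑ i, ∑ j, L (Pi.single i 1) * (L (Pi.single j 1) * cov[X (t i), X (t j); μ]) := by
    have hae : AEMeasurable (fun ω => ∑ j, L (Pi.single j 1) * X (t j) ω) μ :=
      Finset.aemeasurable_fun_sum _ fun j _ => (hmem (t j)).aemeasurable.const_mul _
    rw [hL, ← covariance_self hae, covariance_fun_sum_fun_sum
      (fun i => (hmem (t i)).const_mul _) (fun i => (hmem (t i)).const_mul _)]
    simp only [covariance_const_mul_left, covariance_const_mul_right]
    refine Finset.sum_congr rfl fun i _ => Finset.sum_congr rfl fun j _ => ?_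
    ring
  rw [(hlaw t).charFunDual_map_eq_fun, (hlaw _).charFunDual_map_eq_fun, hm, hm, hv, hv]
  congr 4
  exact Finset.sum_congr rfl fun i _ => Finset.sum_congr rfl fun j _ => by rw [hcov _ _ r]

end Stationarity

/-! ### Tilting by increments of the process -/

section Increments

theorem isGaussianProcess_sub_const {T E Ω : Type*} [NormedAddCommGroup E] [NormedSpace ℝ E]
    [CompleteSpace E] [SecondCountableTopology E] [MeasurableSpace E] [BorelSpace E]
    [MeasurableSpace Ω] {μ : Measure Ω} {X : T → Ω → E} (hX : IsGaussianProcess X μ) (m : T → E) :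
    IsGaussianProcess (fun t ω => X t ω - m t) μ := by
  refine ⟨fun I => ⟨?_⟩⟩
  have hI := hX.hasGaussianLaw I
  have := hI.isGaussian_map
  have hmap : μ.map (fun ω => I.restrict fun t => X t ω - m t) =
      (μ.map fun ω => I.restrict fun t => X t ω).map (fun y => y - I.restrict m) := by
    rw [AEMeasurable.map_map_of_aemeasurable (by fun_prop) hI.aemeasurable]
    rfl
  rw [hmap]
  infer_instance

variable {d : ℕ} {Ω : Type*} [MeasurableSpace Ω] {μ : Measure Ω} [IsProbabilityMeasure μ]
  {Λ M : Measure (Eu d)} {ξ : ℝ → Ω → Eu d}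

/-- The covariance operator of `ξ s` and `ξ t - ξ s`. -/
noncomputable def incrementCov (μ : Measure Ω) (ξ : ℝ → Ω → Eu d) (s t : ℝ) : Eu d →ₗ[ℝ] Eu d :=
  Matrix.toEuclideanLin (covMatrix μ (ξ s) (ξ t)) - Matrix.toEuclideanLin (covMatrix μ (ξ s) (ξ s))

theorem inner_incrementCov (hξ : ∀ t, MemLp (ξ t) 2 μ) (s t : ℝ) (u w : Eu d) :
    inner ℝ u (incrementCov μ ξ s t w) =
      cov[fun ω => inner ℝ u (ξ s ω), fun ω => inner ℝ w (ξ t ω - ξ s ω); μ] := by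
  have hmem (u : Eu d) (t : ℝ) : MemLp (fun ω => (inner ℝ u (ξ t ω) : ℝ)) 2 μ :=
    (hξ t).const_inner u
  simp only [incrementCov, LinearMap.sub_apply, inner_sub_right]
  rw [inner_toEuclideanLin_covMatrix (hξ s) (hξ t), inner_toEuclideanLin_covMatrix (hξ s) (hξ s),
    covariance_fun_sub_right (hmem _ _) (hmem _ _) (hmem _ _)]

/-- The Cameron-Martin formula for the tilting of `Λ * P_s` by an increment of `ξ`. -/
theorem lintegral_exp_increment_mul (hξm : ∀ t, Measurable (ξ t)) (hξ : IsGaussianProcess ξ μ)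
    (s t : ℝ) (w : Eu d) {f : Eu d → ℝ≥0∞} (hf : Measurable f) :
    ∫⁻ z, ∫⁻ ω, ENNReal.ofReal (Real.exp (inner ℝ w ((z + ξ t ω) - (z + ξ s ω)))) * f (z + ξ s ω)
        ∂μ ∂Λ =
      ∫⁻ y, f y ∂(ENNReal.ofReal (Real.exp (inner ℝ w ((∫ ω, ξ t ω ∂μ) - ∫ ω, ξ s ω ∂μ) +
          Var[fun ω => inner ℝ w (ξ t ω - ξ s ω); μ] / 2)) •
        (Measure.conv Λ (μ.map (ξ s))).map (· + incrementCov μ ξ s t w)) := by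
  have hL2 (t : ℝ) : MemLp (ξ t) 2 μ := (hξ.hasGaussianLaw_eval t).memLp_two
  have hint (t : ℝ) : Integrable (ξ t) μ := (hL2 t).integrable one_le_two
  have hpair : HasGaussianLaw (fun ω => (ξ s ω, (inner ℝ w (ξ t ω - ξ s ω) : ℝ))) μ :=
    hξ.hasGaussianLaw_prodMk.map_fun ((ContinuousLinearMap.fst ℝ (Eu d) (Eu d)).prod
      ((innerSL ℝ w).comp (ContinuousLinearMap.snd ℝ (Eu d) (Eu d) -
        ContinuousLinearMap.fst ℝ (Eu d) (Eu d))))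
  have hmean : ∫ ω, (inner ℝ w (ξ t ω - ξ s ω) : ℝ) ∂μ =
      inner ℝ w ((∫ ω, ξ t ω ∂μ) - ∫ ω, ξ s ω ∂μ) := by
    rw [integral_inner (f := fun ω => ξ t ω - ξ s ω) ((hint t).sub (hint s)),
      integral_sub (hint t) (hint s)]
  rw [lintegral_smul_measure, lintegral_map hf (by fun_prop),
    lintegral_conv_map (hξm s) _ (by fun_prop), smul_eq_mul, ← lintegral_const_mul]
  · refine lintegral_congr fun z => ?_
    have hcm := lintegral_exp_mul_comp_of_hasGaussianLaw (hξm s) (by fun_prop) hpair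
      (fun u => inner_incrementCov hL2 s t u w) (f := fun y => f (z + y)) (by fun_prop)
    rw [hmean] at hcm
    simp only [add_sub_add_left_eq_sub]
    simpa only [add_assoc] using hcm
  · exact Measurable.lintegral_prod_right'
      (f := fun p : Eu d × Ω => f (p.1 + ξ s p.2 + incrementCov μ ξ s t w)) (by fun_prop)

/-- If the one- and two-point intensities are invariant under time shifts, then the common
one-point intensity is multiplied by an exponential factor under the translations by the changes
of the increment covariances, and the variances of the increments are invariant. -/
theorem hasTranslationExponent_incrementCov [IsLocallyFiniteMeasure M] (hM : M ≠ 0)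
    (hξm : ∀ t, Measurable (ξ t)) (hξ : IsGaussianProcess ξ μ)
    (hconv : ∀ t, Measure.conv Λ (μ.map (ξ t)) = M)
    (hshift : ∀ (s t h : ℝ) (f : Eu d × Eu d → ℝ≥0∞), Measurable f →
      ∫⁻ z, ∫⁻ ω, f (z + ξ s ω, z + ξ t ω) ∂μ ∂Λ =
        ∫⁻ z, ∫⁻ ω, f (z + ξ (s + h) ω, z + ξ (t + h) ω) ∂μ ∂Λ) (s t h : ℝ) (w : Eu d) :
    Var[fun ω => inner ℝ w (ξ t ω - ξ s ω); μ] =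
        Var[fun ω => inner ℝ w (ξ (t + h) ω - ξ (s + h) ω); μ] ∧
      HasTranslationExponent M (incrementCov μ ξ s t w - incrementCov μ ξ (s + h) (t + h) w)
        (inner ℝ w ((∫ ω, ξ (t + h) ω ∂μ) - ∫ ω, ξ (s + h) ω ∂μ) -
          inner ℝ w ((∫ ω, ξ t ω ∂μ) - ∫ ω, ξ s ω ∂μ)) := by
  set v := incrementCov μ ξ s t w with hv
  set v' := incrementCov μ ξ (s + h) (t + h) w with hv'
  set a : ℝ := inner ℝ w ((∫ ω, ξ t ω ∂μ) - ∫ ω, ξ s ω ∂μ) with ha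
  set a' : ℝ := inner ℝ w ((∫ ω, ξ (t + h) ω ∂μ) - ∫ ω, ξ (s + h) ω ∂μ) with ha'
  set q := Var[fun ω => inner ℝ w (ξ t ω - ξ s ω); μ] with hq
  set q' := Var[fun ω => inner ℝ w (ξ (t + h) ω - ξ (s + h) ω); μ] with hq'
  have hvar (r s t : ℝ) : Var[fun ω => inner ℝ (r • w) (ξ t ω - ξ s ω); μ] =
      r ^ 2 * Var[fun ω => inner ℝ w (ξ t ω - ξ s ω); μ] := by
    simp only [inner_smul_left, conj_trivial]
    exact variance_const_mul r _ μ
  -- Scaling `w` by `r` separates the parts: means and shifts scale by `r`, variances by `r ^ 2`.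
  have htilt (r : ℝ) :
      ENNReal.ofReal (Real.exp (r * a + r ^ 2 * q / 2)) • M.map (· + r • v) =
        ENNReal.ofReal (Real.exp (r * a' + r ^ 2 * q' / 2)) • M.map (· + r • v') := by
    refine Measure.ext_of_lintegral _ fun f hf => ?_
    have h₁ := lintegral_exp_increment_mul (Λ := Λ) hξm hξ s t (r • w) hf
    have h₂ := lintegral_exp_increment_mul (Λ := Λ) hξm hξ (s + h) (t + h) (r • w) hf
    rw [hvar, hconv, map_smul, real_inner_smul_left] at h₁ h₂
    rw [ha, ha', hq, hq', hv, hv', ← h₁, ← h₂]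
    exact hshift s t h
      (fun p => ENNReal.ofReal (Real.exp (inner ℝ (r • w) (p.2 - p.1))) * f p.1) (by fun_prop)
  have hquad (r : ℝ) : M.map (· + r • (v - v')) =
      ENNReal.ofReal (Real.exp (r * (a' - a) + r ^ 2 * ((q' - q) / 2))) • M := by
    have h₁ := congrArg (fun ν : Measure (Eu d) =>
      ENNReal.ofReal (Real.exp (-(r * a + r ^ 2 * q / 2))) • ν.map (· + -(r • v'))) (htilt r)
    simp only [Measure.map_smul, smul_smul] at h₁
    rw [Measure.map_map (by fun_prop) (by fun_prop), Measure.map_map (by fun_prop) (by fun_prop),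
      ← ENNReal.ofReal_mul (Real.exp_pos _).le, ← ENNReal.ofReal_mul (Real.exp_pos _).le,
      ← Real.exp_add, ← Real.exp_add] at h₁
    have hc₁ : ((· + -(r • v')) ∘ (· + r • v) : Eu d → Eu d) = (· + r • (v - v')) := by
      ext1 x
      simp only [Function.comp_apply, smul_sub]
      abel
    have hc₂ : ((· + -(r • v')) ∘ (· + r • v') : Eu d → Eu d) = id := by
      ext1 x
      simp
    rw [hc₁, hc₂, Measure.map_id, neg_add_cancel, Real.exp_zero, ENNReal.ofReal_one, one_smul] at h₁
    rw [h₁]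
    congr 3
    ring
  obtain ⟨hzero, hexp⟩ := HasTranslationExponent.of_quadratic hM hquad
  exact ⟨by linarith, hexp⟩

/-- Unless a projection of the centred process is stationary, the changes of the increment
covariances span the whole space. -/
theorem eq_top_of_incrementCov_mem (hξ : IsGaussianProcess ξ μ)
    (hlin : ∀ u : Eu d, u ≠ 0 →
      ¬ IsStationaryProcess μ (fun t ω => inner ℝ u (ξ t ω - ∫ ω', ξ t ω' ∂μ)))
    (S : Submodule ℝ (Eu d))
    (hS : ∀ s t h w, incrementCov μ ξ s t w - incrementCov μ ξ (s + h) (t + h) w ∈ S) : S = ⊤ := by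
  rw [← Submodule.orthogonal_eq_bot_iff, Submodule.eq_bot_iff]
  intro u hu
  by_contra hu0
  refine hlin u hu0 ?_
  have hL2 (t : ℝ) : MemLp (ξ t) 2 μ := (hξ.hasGaussianLaw_eval t).memLp_two
  have hint (t : ℝ) : Integrable (ξ t) μ := (hL2 t).integrable one_le_two
  have hmem (t : ℝ) : MemLp (fun ω => (inner ℝ u (ξ t ω) : ℝ)) 2 μ := (hL2 t).const_inner u
  have hcov (s t r : ℝ) : cov[fun ω => (inner ℝ u (ξ s ω) : ℝ), fun ω => inner ℝ u (ξ t ω); μ] =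
      cov[fun ω => (inner ℝ u (ξ (s + r) ω) : ℝ), fun ω => inner ℝ u (ξ (t + r) ω); μ] := by
    refine shift_invariant_of_sub_diagonal
      (C := fun s t => cov[fun ω => (inner ℝ u (ξ s ω) : ℝ), fun ω => inner ℝ u (ξ t ω); μ])
      (fun s t => covariance_comm _ _) (fun t => ?_) (fun s t r => ?_) s t r
    · rw [covariance_self (hmem t).aemeasurable]
      exact variance_nonneg _ _
    -- Orthogonality is used only with `w = u`.
    · have h₁ : (inner ℝ u (incrementCov μ ξ s t u - incrementCov μ ξ (s + r) (t + r) u) : ℝ) = 0 :=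
        (Submodule.mem_orthogonal' S u).1 hu _ (hS s t r u)
      rw [inner_sub_right, inner_incrementCov hL2, inner_incrementCov hL2] at h₁
      simp only [inner_sub_right] at h₁
      rw [covariance_fun_sub_right (hmem _) (hmem _) (hmem _),
        covariance_fun_sub_right (hmem _) (hmem _) (hmem _)] at h₁
      linarith
  have hY : IsGaussianProcess (fun t ω => (inner ℝ u (ξ t ω - ∫ ω', ξ t ω' ∂μ) : ℝ)) μ :=
    (isGaussianProcess_sub_const hξ fun t => ∫ ω', ξ t ω' ∂μ).comp_left fun _ => innerSL ℝ u
  refine isStationaryProcess_of_covariance hY (fun t => ?_) fun s t r => ?_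
  · have := integral_inner (𝕜 := ℝ) (f := fun ω => ξ t ω - ∫ ω', ξ t ω' ∂μ)
      ((hint t).sub (integrable_const _)) u
    rw [this, integral_sub (hint t) (integrable_const _)]
    simp
  · simp only [inner_sub_right]
    rw [covariance_sub_const_left ((hmem _).integrable one_le_two),
      covariance_sub_const_right ((hmem _).integrable one_le_two),
      covariance_sub_const_left ((hmem _).integrable one_le_two),
      covariance_sub_const_right ((hmem _).integrable one_le_two), hcov s t r]

end Increments

/-! ### The representation of the process -/

theorem hasExponentialForm_of_invariance {d : ℕ} {Ω : Type*} [MeasurableSpace Ω] {μ : Measure Ω}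
    [IsProbabilityMeasure μ] {ξ : ℝ → Ω → Eu d} {l : Eu d} (hξ : IsGaussianProcess ξ μ)
    (hvar : ∀ s t h w, Var[fun ω => inner ℝ w (ξ t ω - ξ s ω); μ] =
      Var[fun ω => inner ℝ w (ξ (t + h) ω - ξ (s + h) ω); μ])
    (hmean : ∀ s t h w, (inner ℝ w ((∫ ω, ξ (t + h) ω ∂μ) - ∫ ω, ξ (s + h) ω ∂μ) -
        inner ℝ w ((∫ ω, ξ t ω ∂μ) - ∫ ω, ξ s ω ∂μ) : ℝ) =
      inner ℝ l (incrementCov μ ξ s t w - incrementCov μ ξ (s + h) (t + h) w))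
    (hconst : ∀ t, inner ℝ l (∫ ω, ξ t ω ∂μ) + Var[fun ω => inner ℝ l (ξ t ω); μ] / 2 =
      inner ℝ l (∫ ω, ξ 0 ω ∂μ) + Var[fun ω => inner ℝ l (ξ 0 ω); μ] / 2) :
    HasExponentialForm μ ξ l := by
  have hL2 (t : ℝ) : MemLp (ξ t) 2 μ := (hξ.hasGaussianLaw_eval t).memLp_two
  have hint (t : ℝ) : Integrable (ξ t) μ := (hL2 t).integrable one_le_two
  set m : ℝ → Eu d := fun t => ∫ ω, ξ t ω ∂μ with hm
  set κ : ℝ → ℝ → Eu d := fun s t => Matrix.toEuclideanLin (covMatrix μ (ξ s) (ξ t)) l with hκ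
  -- `hmean` holds for every `w`; transposing the covariance operators turns it into a vector
  -- identity.
  have hshift (s t h : ℝ) : m t - m s + (κ t s - κ s s) =
      m (t + h) - m (s + h) + (κ (t + h) (s + h) - κ (s + h) (s + h)) := by
    refine ext_inner_left ℝ fun w => ?_
    have hw := hmean s t h w
    have hcomm (s t : ℝ) : (inner ℝ l (incrementCov μ ξ s t w) : ℝ) =
        inner ℝ w (κ t s - κ s s) := by
      rw [incrementCov, LinearMap.sub_apply, inner_sub_right, inner_sub_right,
        inner_toEuclideanLin_covMatrix_comm (hL2 s) (hL2 t),
        inner_toEuclideanLin_covMatrix_comm (hL2 s) (hL2 s)]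
    rw [inner_sub_right l, hcomm, hcomm] at hw
    rw [inner_add_right, inner_add_right]
    linarith
  have hθ (t : ℝ) : (inner ℝ (m t + (1 / 2 : ℝ) • κ t t) l : ℝ) =
      inner ℝ l (m t) + Var[fun ω => inner ℝ l (ξ t ω); μ] / 2 := by
    have hv : (inner ℝ l (κ t t) : ℝ) = Var[fun ω => inner ℝ l (ξ t ω); μ] := by
      rw [hκ, inner_toEuclideanLin_covMatrix (hL2 t) (hL2 t),
        covariance_self ((hL2 t).const_inner l).aemeasurable]
    rw [real_inner_comm, inner_add_right, inner_smul_right, hv]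
    ring
  -- The constant `c` is the value of `m + κ / 2` at time `0`; subtracting it makes `b` orthogonal
  -- to `l`, because `hconst` says that the pairing of `m + κ / 2` with `l` does not vary.
  refine ⟨fun t ω => ξ t ω - m t, fun t => m t + (1 / 2 : ℝ) • κ t t - (m 0 + (1 / 2 : ℝ) • κ 0 0),
    m 0 + (1 / 2 : ℝ) • κ 0 0, isGaussianProcess_sub_const hξ m, fun t => ?_, ?_,
    fun t => covMatrix_sub_const (hL2 t) (hL2 t) _ _, fun t => ?_, ?_, fun t ω => ?_⟩
  · rw [integral_sub (hint t) (integrable_const _)]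
    simp [hm]
  · refine ⟨fun τ => covMatrix μ (fun ω => ξ 0 ω - ξ τ ω) (fun ω => ξ 0 ω - ξ τ ω),
      fun t₁ t₂ => ?_⟩
    have hL2' (s t : ℝ) : MemLp (fun ω => ξ t ω - ξ s ω) 2 μ := (hL2 t).sub (hL2 s)
    have hsub : (fun ω => (ξ t₂ ω - m t₂) - (ξ t₁ ω - m t₁)) =
        fun ω => (ξ t₂ ω - ξ t₁ ω) - (m t₂ - m t₁) := by
      ext1 ω
      abel
    rw [hsub, covMatrix_sub_const (hL2' t₁ t₂) (hL2' t₁ t₂)]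
    refine covMatrix_self_eq_of_variance_inner_eq (hL2' t₁ t₂) (hL2' _ 0) fun w => ?_
    have := hvar (t₁ - t₂) 0 t₂ w
    rw [zero_add, sub_add_cancel] at this
    exact this.symm
  · rw [inner_sub_left, hθ, hθ, hconst t, sub_self]
  -- Half the antisymmetric part of the shift-invariant expression in `hshift`: the diagonal terms
  -- supply the `κ t t / 2` in `b`, the off-diagonal ones the correction.
  · refine ⟨fun τ => (1 / 2 : ℝ) • ((m τ - m 0 + (κ τ 0 - κ 0 0)) -
      (m (-τ) - m 0 + (κ (-τ) 0 - κ 0 0))), fun t₁ t₂ => ?_⟩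
    have h₁ := hshift 0 (t₂ - t₁) t₁
    have h₂ := hshift 0 (-(t₂ - t₁)) t₂
    rw [zero_add, sub_add_cancel] at h₁
    rw [zero_add, neg_sub, sub_add_cancel] at h₂
    simp only [neg_sub]
    rw [h₁, h₂, map_sub, LinearMap.sub_apply]
    change m t₂ + (1 / 2 : ℝ) • κ t₂ t₂ - (m 0 + (1 / 2 : ℝ) • κ 0 0) -
      (m t₁ + (1 / 2 : ℝ) • κ t₁ t₁ - (m 0 + (1 / 2 : ℝ) • κ 0 0)) +
      (1 / 2 : ℝ) • (κ t₂ t₁ - κ t₁ t₂) = _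
    module
  · change ξ t ω = ξ t ω - m t - (1 / 2 : ℝ) • κ t t +
      (m t + (1 / 2 : ℝ) • κ t t - (m 0 + (1 / 2 : ℝ) • κ 0 0)) + (m 0 + (1 / 2 : ℝ) • κ 0 0)
    abel

end ParticleSystem

/-! ### Proof of the theorem -/

open ParticleSystem in
theorem corollary4p9 {d : ℕ} {Ω Ω' : Type*} [MeasurableSpace Ω] [MeasurableSpace Ω']
    (P : Measure Ω) [IsProbabilityMeasure P] (μ : Measure Ω') [IsProbabilityMeasure μ]
    (Λ : Measure (ParticleSystem.Eu d)) (ξ : ℝ → Ω' → ParticleSystem.Eu d)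
    (K : Ω → ℕ∞) (x : ℕ → Ω → ParticleSystem.Eu d) (Ξ : ℕ → ℝ → Ω → ParticleSystem.Eu d)
    (hΛ : Λ ≠ 0)
    (hξm : ∀ t, Measurable (ξ t))
    (hξ : IsGaussianProcess ξ μ)
    (hfin : ∀ t, IsLocallyFiniteMeasure (Measure.conv Λ (μ.map (ξ t))))
    (hsys : ParticleSystem.IsGeneratedBy P K x Ξ Λ μ ξ)
    (hstat : ParticleSystem.IsStationarySystem P K x Ξ)
    (σ : Measure (ParticleSystem.Eu d)) (hσ : IsGaussian σ)
    (t₁ t₂ : ℝ) (ht : t₁ ≠ t₂)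
    (hdecomp : μ.map (ξ t₁) = Measure.conv (μ.map (ξ t₂)) σ)
    (hlin : ∀ u : ParticleSystem.Eu d, u ≠ 0 →
      ¬ ParticleSystem.IsStationaryProcess μ
        (fun t ω => inner ℝ u (ξ t ω - ∫ ω', ξ t ω' ∂μ))) :
    ∃ (c : ℝ≥0) (l : ParticleSystem.Eu d), 0 < c ∧
      Λ = c • ParticleSystem.expMeasure l ∧
      ParticleSystem.HasExponentialForm μ ξ l := by
  have hprob (t : ℝ) : IsProbabilityMeasure (μ.map (ξ t)) :=
    Measure.isProbabilityMeasure_map (hξm t).aemeasurable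
  have hfin₀ := hfin 0
  have hloc : IsLocallyFiniteMeasure Λ := isLocallyFiniteMeasure_of_conv (ν := μ.map (ξ 0))
  have hshift (s t h : ℝ) (f : Eu d × Eu d → ℝ≥0∞) (hf : Measurable f) :=
    hstat.lintegral_pair_shift hsys hξm s t h hf
  set M : Measure (Eu d) := Measure.conv Λ (μ.map (ξ 0)) with hM
  have hconv (t : ℝ) : Measure.conv Λ (μ.map (ξ t)) = M := by
    refine Measure.ext_of_lintegral _ fun f hf => ?_
    rw [lintegral_conv_map (hξm t) _ hf, hM, lintegral_conv_map (hξm 0) _ hf]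
    simpa using (hshift 0 0 t (fun p => f p.1) (by fun_prop)).symm
  have hM0 : M ≠ 0 := by
    intro h0
    have huniv := lintegral_conv_map (μ := μ) (hξm 0) Λ (f := fun _ => 1) measurable_const
    rw [← hM, h0] at huniv
    exact hΛ (Measure.measure_univ_eq_zero.1 (by simpa using huniv.symm))
  have hincr := hasTranslationExponent_incrementCov hM0 hξm hξ hconv hshift
  let S : Submodule ℝ (Eu d) :=
    { carrier := {v | ∃ k, HasTranslationExponent M v k}
      add_mem' := fun ⟨k, hk⟩ ⟨k', hk'⟩ => ⟨k + k', hk.add hk'⟩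
      zero_mem' := ⟨0, HasTranslationExponent.zero⟩
      smul_mem' := fun a _ ⟨k, hk⟩ => ⟨a * k, hk.smul a⟩ }
  have hS : S = ⊤ := eq_top_of_incrementCov_mem hξ hlin S fun s t h w => ⟨_, (hincr s t h w).2⟩
  obtain ⟨c, l, hc, hMc⟩ := exists_eq_smul_expMeasure hM0 fun v =>
    (hS ▸ Submodule.mem_top : v ∈ S)
  have hexp (v : Eu d) : HasTranslationExponent M v (inner ℝ l v) := by
    intro r
    rw [hMc, Measure.map_smul, map_add_right_expMeasure, inner_smul_right, smul_comm]
  set θ : ℝ → ℝ := fun t =>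
    inner ℝ l (∫ ω, ξ t ω ∂μ) + Var[fun ω => inner ℝ l (ξ t ω); μ] / 2 with hθ
  have hconvExp (t : ℝ) (c : ℝ≥0) : Measure.conv (c • expMeasure l) (μ.map (ξ t)) =
      ENNReal.ofReal (Real.exp (θ t)) • c • expMeasure l :=
    conv_smul_expMeasure (hξm t) (hξ.hasGaussianLaw_eval t) c l
  -- Convolving with the law of `ξ 0` multiplies `expMeasure l` by `exp (θ 0)`, which this constant
  -- compensates.
  have hΛeq : Λ = (c * (Real.exp (-θ 0)).toNNReal) • expMeasure l := by
    refine eq_of_conv_map_eq (hξm 0) (hξ.hasGaussianLaw_eval 0) (fun u a => ?_) ?_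
    · rw [hconv, hMc]
      exact lintegral_exp_mul_gaussian_expMeasure_ne_top c l u a
    · rw [hconvExp, hconv, hMc]
      change c • expMeasure l = (Real.exp (θ 0)).toNNReal • _ • expMeasure l
      rw [smul_smul, mul_left_comm, ← Real.toNNReal_mul (Real.exp_pos _).le, ← Real.exp_add,
        add_neg_cancel, Real.exp_zero, Real.toNNReal_one, mul_one]
  refine ⟨c * (Real.exp (-θ 0)).toNNReal, l,
    mul_pos hc (Real.toNNReal_pos.2 (Real.exp_pos _)), hΛeq,
    hasExponentialForm_of_invariance hξ (fun s t h w => (hincr s t h w).1)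
      (fun s t h w => (hincr s t h w).2.unique hM0 (hexp _)) fun t => ?_⟩
  -- `θ` is constant because `exp (θ t) • Λ` is `Λ * P_t`, which is `M` for every `t`.
  refine eq_of_ofReal_exp_smul_eq hΛ ?_
  have h₁ := hconvExp t (c * (Real.exp (-θ 0)).toNNReal)
  have h₂ := hconvExp 0 (c * (Real.exp (-θ 0)).toNNReal)
  rw [← hΛeq, hconv] at h₁ h₂
  exact h₁.symm.trans h₂
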